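/- Let $K$ be an infinite field, $n\ge 2$ an integer and $\Gamma=\mathrm{GL}_n(K)$. For $1\le i,j\le n$ let $c_{ij},\tilde c_{ij}:\Gamma\to K$ be the functions sending $A$ to the $(i,j)$ entry of $A$ and of $A^{-1}$, respectively. Let $\tilde A$ be the $K$-algebra of functions on $\Gamma$ generated by all $c_{ij}$ and $\det^{-1}$. For integers $r,s\ge 0$ let $\tilde A(r,s)$ be the $K$-span of all products of $r$ functions $c_{ij}$ and $s$ functions $\tilde c_{ij}$; one has $\tilde A(r,s)\subset\tilde A(r+1,s+1)$. For an integer $z\ge 0$ put $\tilde A_z=\bigcup_{t\ge 0}\tilde A(z+t,t)$ and $\tilde A_{-z}=\bigcup_{t\ge 0}\tilde A(t,z+t)$. For a (possibly infinite dimensional) $K\Gamma$-module $V$ let $\mathrm{cf}(V)$ be the $K$-span of the functions $g\mapsto\varphi(gv)$ on $\Gamma$, with $v\in V$ and $\varphi$ in the linear dual of $V$. The module $V$ is rational if $\mathrm{cf}(V)\subset\tilde A$, and has bidegree $(r,s)$ if $\mathrm{cf}(V)\subset\tilde A(r,s)$. A finite dimensional rational $V$ has rational degree $z\in\mathbb Z$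 if $\mathrm{cf}(V)\subset\tilde A_z$; an infinite dimensional $V$ has rational degree $z$ if it is the union of finite dimensional rational submodules of rational degree $z$. Theorem. Every rational $K\Gamma$-module $V$ has a direct sum decomposition $V=\bigoplus_{z\in\mathbb Z}V_z$, where each $V_z$ is a rational $K\Gamma$-submodule of rational degree $z$, such that: (i) if $z\ge 0$, then $V_z$ is the union of an ascending chain $V_{z,0}\subset V_{z+1,1}\subset\cdots\subset V_{z+t,t}\subset\cdots$ of rational $K\Gamma$-submodules, with $V_{z+t,t}$ of bidegree $(z+t,t)$ for every $t\ge0$; (ii) if $z\le 0$, then $V_z$ is the union of an ascending chain $V_{0,-z}\subset V_{1,-z+1}\subset\cdots\subset V_{t,-z+t}\subset\cdots$ of rational $K\Gamma$-submodules, with $V_{t,-z+t}$ of bidegree $(t,-z+t)$ for every $t\ge 0$. -/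

import Mathlib

namespace RationalGL

/-- The coefficient space of a representation `ρ` of a monoid `G` on `V`: the subspace of the
`K`-valued functions on `G` spanned by the functions `g ↦ φ (ρ g v)`, for `v` in `V` and `φ` in the
full linear dual of `V`. The coefficient functions `r_ab` for a basis of `V` are those with `v`
and `φ` a basis vector and a coordinate functional, and every nonzero `φ` is a coordinate
functional for some basis, so this is the basis-free form of the coefficient space. -/
def coeffSpace {K G V : Type*} [Field K] [Monoid G] [AddCommGroup V] [Module K V]
    (ρ : Representation K G V) : Submodule K (G → K) :=
  Submodule.span K {f | ∃ (φ : Module.Dual K V) (v : V), f = fun g => φ (ρ g v)}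

/-- For a finite basis, the coefficient space is spanned by the coefficient functions `r_ab`
given by `ρ g (b j) = ∑ i, r_ij g • b i`. -/
theorem coeffSpace_eq_span_basis {K G V ι : Type*} [Field K] [Monoid G] [AddCommGroup V]
    [Module K V] [Fintype ι] (ρ : Representation K G V) (b : Module.Basis ι K V) :
    coeffSpace ρ = Submodule.span K {f | ∃ i j : ι, f = fun g => b.repr (ρ g (b j)) i} := by
  apply le_antisymm
  · refine Submodule.span_le.2 ?_
    rintro f ⟨φ, v, rfl⟩
    have h : (fun g => φ (ρ g v)) =
        ∑ i, ∑ j, (φ (b i) * b.repr v j) • (fun g => b.repr (ρ g (b j)) i) := by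
      funext g
      have h1 : φ (ρ g v) = ∑ i, b.repr (ρ g v) i * φ (b i) := by
        conv_lhs => rw [← b.sum_repr (ρ g v)]
        simp only [map_sum, map_smul, smul_eq_mul]
      have h2 : ∀ i, b.repr (ρ g v) i = ∑ j, b.repr v j * b.repr (ρ g (b j)) i := by
        intro i
        conv_lhs => rw [← b.sum_repr v]
        simp only [map_sum, map_smul, smul_eq_mul, Finsupp.finsetSum_apply, Finsupp.smul_apply]
      rw [h1]
      simp only [Finset.sum_apply, Pi.smul_apply, smul_eq_mul]
      refine Finset.sum_congr rfl fun i _ => ?_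
      rw [h2 i, Finset.sum_mul]
      exact Finset.sum_congr rfl fun j _ => by ring
    rw [h]
    exact Submodule.sum_mem _ fun i _ => Submodule.sum_mem _ fun j _ =>
      Submodule.smul_mem _ _ (Submodule.subset_span ⟨i, j, rfl⟩)
  · refine Submodule.span_mono ?_
    rintro f ⟨i, j, rfl⟩
    exact ⟨b.coord i, b j, rfl⟩

/-- The coordinate function `c_ij` on `GL_n(K)`: the `(i, j)` entry of `A`. -/
def c {n : ℕ} {K : Type*} [Field K] (i j : Fin n) : Matrix.GeneralLinearGroup (Fin n) K → K :=
  fun A => (A : Matrix (Fin n) (Fin n) K) i j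

/-- The function on `GL_n(K)` sending `A` to the `(i, j)` entry of the inverse of `A`. -/
def cInv {n : ℕ} {K : Type*} [Field K] (i j : Fin n) : Matrix.GeneralLinearGroup (Fin n) K → K :=
  fun A => c i j A⁻¹

/-- The function `A ↦ (det A)⁻¹` on `GL_n(K)`. -/
def dInv (n : ℕ) (K : Type*) [Field K] : Matrix.GeneralLinearGroup (Fin n) K → K :=
  fun A => (Matrix.det (A : Matrix (Fin n) (Fin n) K))⁻¹

/-- The algebra of rational (regular) functions on `GL_n(K)`, generated by the `c_ij` and the
inverse of the determinant. -/
def regularAlgebra (n : ℕ) (K : Type*) [Field K] :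
    Subalgebra K (Matrix.GeneralLinearGroup (Fin n) K → K) :=
  Algebra.adjoin K ({f | ∃ i j : Fin n, f = c i j} ∪ {dInv n K})

/-- The span of all products of `r` functions `c_ij` and `s` functions `cInv i j`. -/
def bidegreeSpace (n : ℕ) (K : Type*) [Field K] (r s : ℕ) :
    Submodule K (Matrix.GeneralLinearGroup (Fin n) K → K) :=
  Submodule.span K {f | ∃ a b : Fin n → Fin n → ℕ,
    (∑ i, ∑ j, a i j) = r ∧ (∑ i, ∑ j, b i j) = s ∧
    f = (∏ i, ∏ j, c i j ^ a i j) * ∏ i, ∏ j, cInv i j ^ b i j}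

/-- The space of rational functions of degree `z`: the union of the chain of
`bidegreeSpace n K (z + t) t` if `0 ≤ z`, and of `bidegreeSpace n K t (-z + t)` if `z ≤ 0`.
It is written as a supremum, which is the union by `mem_degreeSpace_iff` below. -/
def degreeSpace (n : ℕ) (K : Type*) [Field K] (z : ℤ) :
    Submodule K (Matrix.GeneralLinearGroup (Fin n) K → K) :=
  ⨆ t : ℕ, bidegreeSpace n K (z.toNat + t) ((-z).toNat + t)

theorem sum_c_mul_cInv {n : ℕ} {K : Type*} [Field K] (i : Fin n) :
    (∑ k, c i k * cInv k i : Matrix.GeneralLinearGroup (Fin n) K → K) = 1 := by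
  funext A
  have h : ((A : Matrix (Fin n) (Fin n) K) *
      ((A⁻¹ : Matrix.GeneralLinearGroup (Fin n) K) : Matrix (Fin n) (Fin n) K)) i i = 1 := by
    rw [← Units.val_mul, mul_inv_cancel]
    simp
  simpa [Matrix.mul_apply, c, cInv, Finset.sum_apply] using h

theorem bidegreeSpace_le_succ {n : ℕ} (hn : 0 < n) (K : Type*) [Field K] (r s : ℕ) :
    bidegreeSpace n K r s ≤ bidegreeSpace n K (r + 1) (s + 1) := by
  classical
  have key : ∀ (x : Fin n → Fin n → Matrix.GeneralLinearGroup (Fin n) K → K)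
      (a : Fin n → Fin n → ℕ) (k l : Fin n),
      (∏ i, ∏ j, x i j ^ (a i j + if i = k ∧ j = l then 1 else 0)) =
        (∏ i, ∏ j, x i j ^ a i j) * x k l := by
    intro x a k l
    simp only [pow_add, Finset.prod_mul_distrib]
    congr 1
    rw [Finset.prod_eq_single k, Finset.prod_eq_single l] <;> simp +contextual
  have keys : ∀ (a : Fin n → Fin n → ℕ) (k l : Fin n),
      (∑ i, ∑ j, (a i j + if i = k ∧ j = l then 1 else 0)) = (∑ i, ∑ j, a i j) + 1 := by
    intro a k l
    simp only [Finset.sum_add_distrib]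
    congr 1
    rw [Finset.sum_eq_single k, Finset.sum_eq_single l] <;> simp +contextual
  refine Submodule.span_le.2 ?_
  rintro f ⟨a, b, rfl, rfl, rfl⟩
  let i₀ : Fin n := ⟨0, hn⟩
  rw [SetLike.mem_coe, ← mul_one ((∏ i, ∏ j, c i j ^ a i j) * ∏ i, ∏ j, cInv i j ^ b i j),
    ← sum_c_mul_cInv i₀, Finset.mul_sum]
  refine Submodule.sum_mem _ fun k _ => Submodule.subset_span
    ⟨fun i j => a i j + if i = i₀ ∧ j = k then 1 else 0,
      fun i j => b i j + if i = k ∧ j = i₀ then 1 else 0, keys a i₀ k, keys b k i₀, ?_⟩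
  rw [key c a i₀ k, key cInv b k i₀]
  ring

theorem mem_degreeSpace_iff {n : ℕ} (hn : 0 < n) {K : Type*} [Field K] (z : ℤ)
    (f : Matrix.GeneralLinearGroup (Fin n) K → K) :
    f ∈ degreeSpace n K z ↔ ∃ t : ℕ, f ∈ bidegreeSpace n K (z.toNat + t) ((-z).toNat + t) := by
  refine Submodule.mem_iSup_of_directed _ (Monotone.directed_le ?_)
  exact monotone_nat_of_le_succ fun t => bidegreeSpace_le_succ hn K _ _

section Modules

variable {n : ℕ} {K : Type*} [Field K] {V : Type*} [AddCommGroup V] [Module K V]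

/-- A representation of `GL_n(K)`, of any dimension, is rational if its coefficient space consists
of rational functions on `GL_n(K)`. -/
def IsRational (ρ : Representation K (Matrix.GeneralLinearGroup (Fin n) K) V) : Prop :=
  coeffSpace ρ ≤ Subalgebra.toSubmodule (regularAlgebra n K)

/-- A representation of `GL_n(K)`, of any dimension, has bidegree `(r, s)` if its coefficient space
lies in `bidegreeSpace n K r s`. -/
def HasBidegree (ρ : Representation K (Matrix.GeneralLinearGroup (Fin n) K) V) (r s : ℕ) : Prop :=
  coeffSpace ρ ≤ bidegreeSpace n K r s

/-- A rational representation has rational degree `z` if, when it is finite dimensional, its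
coefficient space lies in `degreeSpace n K z` and, when it is infinite dimensional, it is the union
of its finite dimensional rational submodules of degree `z`. -/
def HasDegree (ρ : Representation K (Matrix.GeneralLinearGroup (Fin n) K) V) (z : ℤ) : Prop :=
  (FiniteDimensional K V → coeffSpace ρ ≤ degreeSpace n K z) ∧
  (¬ FiniteDimensional K V → ∀ v : V, ∃ W : Subrepresentation ρ, v ∈ W ∧
    FiniteDimensional K W.toSubmodule ∧ IsRational W.toRepresentation ∧
    coeffSpace W.toRepresentation ≤ degreeSpace n K z)

end Modules

end RationalGL

/-! The decomposition is the weight decomposition under the scalar matrices: functions in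
`degreeSpace n K z` are multiplied by `x ^ z` under translation by the scalar `x`. Over an infinite
field these characters are distinct, hence independent, so finite combinations of scalars act as
projections onto single degrees. This gives independence of the components
(`iSupIndep_degreeComponent`) and, applied to a vector, its homogeneous parts
(`iSup_degreeComponent`). In infinite dimension the missing ingredient is local finiteness
(`finiteDimensional_orbitSpan`). The dual of a cyclic submodule embeds in the regular algebra, which
has countable dimension, while an infinite-dimensional space has a dual of uncountable dimension. So
each vector has a finite-dimensional space of coefficient functions, which meets only finitely many
degrees and, within one degree, lies in one bidegree space. -/

namespace RationalGL

open Matrix (GeneralLinearGroup)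

/-! ### Coefficient functions and local finiteness -/

section Abstract

variable {K G V : Type*} [Field K] [Monoid G] [AddCommGroup V] [Module K V]

/-- The linear map sending a functional `φ` to the coefficient function `g ↦ φ (ρ g v)`. -/
def coeffMap (ρ : Representation K G V) (v : V) : Module.Dual K V →ₗ[K] (G → K) where
  toFun φ g := φ (ρ g v)
  map_add' _ _ := rfl
  map_smul' _ _ := rfl

@[simp]
theorem coeffMap_apply (ρ : Representation K G V) (v : V) (φ : Module.Dual K V) (g : G) :
    coeffMap ρ v φ g = φ (ρ g v) := rfl

theorem coeffMap_mem_coeffSpace (ρ : Representation K G V) (v : V) (φ : Module.Dual K V) :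
    coeffMap ρ v φ ∈ coeffSpace ρ :=
  Submodule.subset_span ⟨φ, v, rfl⟩

theorem coeffSpace_le_iff (ρ : Representation K G V) (F : Submodule K (G → K)) :
    coeffSpace ρ ≤ F ↔ ∀ v φ, coeffMap ρ v φ ∈ F := by
  refine ⟨fun h v φ => h (coeffMap_mem_coeffSpace ρ v φ), fun h => Submodule.span_le.2 ?_⟩
  rintro f ⟨φ, v, rfl⟩
  exact h v φ

/-- Coefficient functions of a subrepresentation are coefficient functions of the ambient
representation. -/
theorem exists_coeffMap_toRepresentation (ρ : Representation K G V) (W : Subrepresentation ρ)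
    (w : W.toSubmodule) (ψ : Module.Dual K W.toSubmodule) :
    ∃ φ : Module.Dual K V, coeffMap W.toRepresentation w ψ = coeffMap ρ (w : V) φ := by
  obtain ⟨φ, hφ⟩ := LinearMap.exists_extend ψ
  refine ⟨φ, ?_⟩
  funext g
  rw [← hφ]
  rfl

theorem coeffSpace_toRepresentation_le (ρ : Representation K G V) (W : Subrepresentation ρ) :
    coeffSpace W.toRepresentation ≤ coeffSpace ρ := by
  rw [coeffSpace_le_iff]
  intro w ψ
  obtain ⟨φ, hφ⟩ := exists_coeffMap_toRepresentation ρ W w ψ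
  exact hφ ▸ coeffMap_mem_coeffSpace ρ _ φ

/-- A space of functions on a monoid is right invariant if it is stable under right
translations. -/
def RightInvariant (F : Submodule K (G → K)) : Prop :=
  ∀ f ∈ F, ∀ h : G, (fun g => f (g * h)) ∈ F

/-- The subrepresentation of all vectors whose coefficient functions lie in a given right
invariant space of functions. -/
def coeffSubrep (ρ : Representation K G V) (F : Submodule K (G → K)) (hF : RightInvariant F) :
    Subrepresentation ρ where
  toSubmodule :=
    { carrier := {v | ∀ φ, coeffMap ρ v φ ∈ F}
      add_mem' := by
        intro v w hv hw φ
        have h : coeffMap ρ (v + w) φ = coeffMap ρ v φ + coeffMap ρ w φ := by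
          funext g; simp
        exact h ▸ F.add_mem (hv φ) (hw φ)
      zero_mem' := by
        intro φ
        have h : coeffMap ρ 0 φ = 0 := by funext g; simp
        exact h ▸ F.zero_mem
      smul_mem' := by
        intro a v hv φ
        have h : coeffMap ρ (a • v) φ = a • coeffMap ρ v φ := by funext g; simp
        exact h ▸ F.smul_mem a (hv φ) }
  apply_mem_toSubmodule h v hv φ := by
    have e : coeffMap ρ (ρ h v) φ = fun g => coeffMap ρ v φ (g * h) := by funext g; simp
    exact e ▸ hF _ (hv φ) h

theorem coeffSpace_coeffSubrep_le (ρ : Representation K G V) (F : Submodule K (G → K))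
    (hF : RightInvariant F) : coeffSpace (coeffSubrep ρ F hF).toRepresentation ≤ F := by
  rw [coeffSpace_le_iff]
  intro w ψ
  obtain ⟨φ, hφ⟩ := exists_coeffMap_toRepresentation ρ _ w ψ
  exact hφ ▸ w.2 φ

/-- The subrepresentation generated by a vector. -/
def orbitSpan (ρ : Representation K G V) (v : V) : Subrepresentation ρ where
  toSubmodule := Submodule.span K (Set.range fun g => ρ g v)
  apply_mem_toSubmodule h w hw := by
    induction hw using Submodule.span_induction with
    | mem x hx =>
      obtain ⟨g, rfl⟩ := hx
      exact Submodule.subset_span ⟨h * g, by simp⟩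
    | zero => simp
    | add x y _ _ hx hy => rw [map_add]; exact add_mem hx hy
    | smul a x _ hx => rw [map_smul]; exact Submodule.smul_mem _ a hx

theorem apply_mem_orbitSpan (ρ : Representation K G V) (v : V) (g : G) :
    ρ g v ∈ (orbitSpan ρ v).toSubmodule := Submodule.subset_span ⟨g, rfl⟩

theorem self_mem_orbitSpan (ρ : Representation K G V) (v : V) :
    v ∈ (orbitSpan ρ v).toSubmodule := by
  simpa using apply_mem_orbitSpan ρ v 1

/-- A functional killing the whole orbit of `v` kills its span. -/
theorem coeffMap_orbitSpan_injective (ρ : Representation K G V) (v : V) :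
    Function.Injective (coeffMap (orbitSpan ρ v).toRepresentation ⟨v, self_mem_orbitSpan ρ v⟩) := by
  rw [← LinearMap.ker_eq_bot, LinearMap.ker_eq_bot']
  intro ψ hψ
  obtain ⟨φ, rfl⟩ := LinearMap.exists_extend ψ
  ext ⟨w, hw⟩
  have : Submodule.span K (Set.range fun g => ρ g v) ≤ LinearMap.ker φ := by
    rw [Submodule.span_le]
    rintro _ ⟨g, rfl⟩
    exact congrFun hψ g
  exact this hw

/-- A vector of a representation whose coefficient space has countable dimension generates a
finite-dimensional subrepresentation. -/
theorem finiteDimensional_orbitSpan (ρ : Representation K G V) (F : Submodule K (G → K))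
    (hF : Module.rank K F ≤ Cardinal.aleph0) (h : coeffSpace ρ ≤ F) (v : V) :
    FiniteDimensional K (orbitSpan ρ v).toSubmodule := by
  by_contra hfin
  have hW : Cardinal.aleph0 ≤ Module.rank K (orbitSpan ρ v).toSubmodule := by
    rw [← not_lt]
    exact fun hlt => hfin (Module.rank_lt_aleph0_iff.1 hlt)
  -- An infinite-dimensional space has a dual of strictly larger dimension, here uncountable, yet
  -- that dual embeds in `F`.
  have hlt := lift_rank_lt_rank_dual hW
  let f : Module.Dual K (orbitSpan ρ v).toSubmodule →ₗ[K] F :=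
    (coeffMap (orbitSpan ρ v).toRepresentation ⟨v, self_mem_orbitSpan ρ v⟩).codRestrict F
      fun ψ => h (coeffSpace_toRepresentation_le ρ _ (coeffMap_mem_coeffSpace _ _ ψ))
  have hf : Function.Injective f := fun a b hab =>
    coeffMap_orbitSpan_injective ρ v (congrArg Subtype.val hab)
  have h1 := LinearMap.lift_rank_le_of_injective f hf
  have h2 : Module.rank K (Module.Dual K (orbitSpan ρ v).toSubmodule) ≤ Cardinal.aleph0 := by
    rw [← Cardinal.lift_le_aleph0]
    exact h1.trans (Cardinal.lift_le_aleph0.2 hF)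
  have h3 := (Cardinal.aleph0_le_lift.2 hW).trans_lt (hlt.trans_le h2)
  exact lt_irrefl _ h3

/-- The coefficient function of `v` at `φ` depends only on the restriction of `φ` to the cyclic
submodule. -/
theorem fg_range_coeffMap (ρ : Representation K G V) (v : V)
    [FiniteDimensional K (orbitSpan ρ v).toSubmodule] : (LinearMap.range (coeffMap ρ v)).FG := by
  have h : LinearMap.range (coeffMap ρ v) ≤ LinearMap.range
      (coeffMap (orbitSpan ρ v).toRepresentation ⟨v, self_mem_orbitSpan ρ v⟩) := by
    rintro _ ⟨φ, rfl⟩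
    exact ⟨φ.comp (orbitSpan ρ v).toSubmodule.subtype, rfl⟩
  exact Module.Finite.iff_fg.1 (Submodule.finiteDimensional_of_le h)

theorem _root_.Submodule.rank_span_le_aleph0 {M : Type*} [AddCommGroup M] [Module K M] {s : Set M}
    (hs : s.Countable) : Module.rank K (Submodule.span K s) ≤ Cardinal.aleph0 :=
  (rank_span_le s).trans (Cardinal.le_aleph0_iff_set_countable.2 hs)

theorem _root_.Submonoid.countable_closure {M : Type*} [Monoid M] {s : Set M} (hs : s.Countable) :
    (Submonoid.closure s : Set M).Countable := by
  have := hs.to_subtype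
  rw [Submonoid.closure_eq_mrange]
  exact Set.countable_range _

end Abstract

/-! ### Independence of the power characters -/

section Characters

variable (K : Type*) [Field K] [Infinite K]

/-- The character `x ↦ x ^ z` of the multiplicative group of a field. -/
def powChar (z : ℤ) : Kˣ →* K := (Units.coeHom K).comp (zpowGroupHom z)

theorem powChar_injective : Function.Injective (powChar K) := by
  have key : ∀ m : ℕ, (∀ x : Kˣ, x ^ m = 1) → m = 0 := by
    intro m hm
    by_contra h0
    have hfin : (Set.univ : Set K).Finite := by
      -- The extra factor `X` makes 0 a root too, so all of `K` consists of roots.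
      have h1 : ((Polynomial.X ^ (m + 1) - Polynomial.X : Polynomial K)) ≠ 0 := by
        intro h
        have := congrArg (fun p => Polynomial.coeff p 1) h
        simp [Polynomial.coeff_X_pow, h0] at this
      refine (Polynomial.finite_setOfPred_isRoot h1).subset fun x _ => ?_
      rcases eq_or_ne x 0 with rfl | hx
      · simp [Polynomial.IsRoot]
      · have := congrArg Units.val (hm (Units.mk0 x hx))
        simp only [Units.val_pow_eq_pow_val, Units.val_mk0, Units.val_one] at this
        simp [Polynomial.IsRoot, pow_succ, this]
    exact Set.infinite_univ hfin
  intro z w hzw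
  have h : ∀ x : Kˣ, x ^ (z - w) = 1 := by
    intro x
    have hx : x ^ z = x ^ w := Units.ext (DFunLike.congr_fun hzw x)
    rw [zpow_sub, hx, mul_inv_cancel]
  have h2 : (z - w).natAbs = 0 := by
    apply key
    intro x
    rcases Int.natAbs_eq (z - w) with e | e
    · have := h x
      rw [e] at this
      simpa using this
    · have := h x
      rw [e] at this
      simpa using this
  omega

/-- Over an infinite field, finite combinations of values can pick out one exponent from any
finite set of exponents. -/
theorem exists_finsupp_sum_zpow (S : Finset ℤ) (z : ℤ) :
    ∃ a : Kˣ →₀ K, ∀ w ∈ S, (a.sum fun x t => t * ((x ^ w : Kˣ) : K)) = if w = z then 1 else 0 := by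
  classical
  let T : (Kˣ →₀ K) →ₗ[K] (S → K) :=
    Finsupp.linearCombination K fun (x : Kˣ) (w : S) => ((x ^ (w : ℤ) : Kˣ) : K)
  have hT : LinearMap.range T = ⊤ := by
    -- A nonzero functional vanishing on the range would be a linear relation between distinct
    -- characters, against Dedekind's theorem.
    by_contra hne
    obtain ⟨f, hf, hle⟩ := Submodule.exists_le_ker_of_lt_top _ (lt_top_iff_ne_top.2 hne)
    have hli : LinearIndependent K fun w : S => (powChar K w : Kˣ → K) :=
      (linearIndependent_monoidHom Kˣ K).comp (fun w : S => powChar K w)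
        ((powChar_injective K).comp Subtype.val_injective)
    have h0 := Fintype.linearIndependent_iff.1 hli (fun w => f (Pi.single w 1)) (by
      funext x
      have hx : f (T (Finsupp.single x 1)) = 0 := hle ⟨_, rfl⟩
      rw [LinearMap.pi_apply_eq_sum_univ f] at hx
      simp only [T, Finsupp.linearCombination_single, one_smul, smul_eq_mul] at hx
      rw [Finset.sum_apply, Pi.zero_apply, ← hx]
      refine Finset.sum_congr rfl fun w _ => ?_
      rw [Pi.smul_apply, smul_eq_mul, mul_comm]
      congr 2
      funext j
      simp [Pi.single_apply, eq_comm])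
    apply hf
    ext w
    simpa using h0 w
  obtain ⟨a, ha⟩ := LinearMap.range_eq_top.1 hT fun w => if (w : ℤ) = z then 1 else 0
  refine ⟨a, fun w hw => ?_⟩
  have := congrFun ha ⟨w, hw⟩
  simp only [T, Finsupp.linearCombination_apply, Finsupp.sum, Finset.sum_apply, Pi.smul_apply,
    smul_eq_mul] at this
  exact this

end Characters

/-! ### Bidegree and degree spaces of functions -/

section Functions

variable {n : ℕ} {K : Type*} [Field K]

instance bidegreeSpace_gradedMonoid :
    SetLike.GradedMonoid fun p : ℕ × ℕ => bidegreeSpace n K p.1 p.2 where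
  one_mem := Submodule.subset_span ⟨0, 0, by simp, by simp, by simp⟩
  mul_mem := by
    intro p q f g hf hg
    have h := Submodule.mul_mem_mul hf hg
    simp only [bidegreeSpace] at h
    rw [Submodule.span_mul_span] at h
    refine Submodule.span_mono ?_ h
    rintro _ ⟨_, ⟨a, b, ha, hb, rfl⟩, _, ⟨a', b', ha', hb', rfl⟩, rfl⟩
    refine ⟨a + a', b + b', ?_, ?_, ?_⟩
    · simp [Finset.sum_add_distrib, ha, ha']
    · simp [Finset.sum_add_distrib, hb, hb']
    · simp only [Pi.add_apply, pow_add, Finset.prod_mul_distrib]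
      ring

theorem mul_mem_bidegreeSpace {r s r' s' : ℕ} {f g : GeneralLinearGroup (Fin n) K → K}
    (hf : f ∈ bidegreeSpace n K r s) (hg : g ∈ bidegreeSpace n K r' s') :
    f * g ∈ bidegreeSpace n K (r + r') (s + s') :=
  SetLike.mul_mem_graded (A := fun p : ℕ × ℕ => bidegreeSpace n K p.1 p.2)
    (i := (r, s)) (j := (r', s')) hf hg

theorem prod_mem_bidegreeSpace {ι : Type*} (F : Finset ι) (r s : ι → ℕ)
    {f : ι → GeneralLinearGroup (Fin n) K → K} (hf : ∀ i ∈ F, f i ∈ bidegreeSpace n K (r i) (s i)) :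
    ∏ i ∈ F, f i ∈ bidegreeSpace n K (∑ i ∈ F, r i) (∑ i ∈ F, s i) := by
  have := SetLike.prod_mem_graded (A := fun p : ℕ × ℕ => bidegreeSpace n K p.1 p.2)
    (fun i => (r i, s i)) f (F := F) hf
  simpa [Prod.fst_sum, Prod.snd_sum] using this

theorem pow_mem_bidegreeSpace (m : ℕ) {r s : ℕ} {f : GeneralLinearGroup (Fin n) K → K}
    (hf : f ∈ bidegreeSpace n K r s) : f ^ m ∈ bidegreeSpace n K (m * r) (m * s) := by
  simpa using SetLike.pow_mem_graded (A := fun p : ℕ × ℕ => bidegreeSpace n K p.1 p.2) m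
    (i := (r, s)) hf

theorem c_mem_bidegreeSpace (i j : Fin n) : c i j ∈ bidegreeSpace n K 1 0 := by
  classical
  refine Submodule.subset_span ⟨fun k l => if k = i then if l = j then 1 else 0 else 0, 0,
    ?_, ?_, ?_⟩
  · rw [Finset.sum_eq_single i] <;> simp +contextual
  · simp
  · rw [Finset.prod_eq_single i, Finset.prod_eq_single j] <;> simp +contextual

theorem cInv_mem_bidegreeSpace (i j : Fin n) : cInv i j ∈ bidegreeSpace n K 0 1 := by
  classical
  refine Submodule.subset_span ⟨0, fun k l => if k = i then if l = j then 1 else 0 else 0,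
    ?_, ?_, ?_⟩
  · simp
  · rw [Finset.sum_eq_single i] <;> simp +contextual
  · rw [mul_comm, Finset.prod_eq_single i, Finset.prod_eq_single j] <;> simp +contextual

/-- Leibniz expansion of the determinant of the inverse matrix. -/
theorem dInv_mem_bidegreeSpace : dInv n K ∈ bidegreeSpace n K 0 n := by
  have h : dInv n K = ∑ σ : Equiv.Perm (Fin n),
      ((Equiv.Perm.sign σ : ℤ) : K) • ∏ i, (cInv (σ i) i : GeneralLinearGroup (Fin n) K → K) := by
    funext A
    have h1 : (Matrix.det (A : Matrix (Fin n) (Fin n) K))⁻¹ =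
        Matrix.det ((A⁻¹ : GeneralLinearGroup (Fin n) K) : Matrix (Fin n) (Fin n) K) := by
      apply inv_eq_of_mul_eq_one_right
      rw [← Matrix.det_mul, ← Units.val_mul, mul_inv_cancel]
      simp
    rw [dInv, h1, Matrix.det_apply']
    simp only [Finset.sum_apply, Pi.smul_apply, Finset.prod_apply,
      smul_eq_mul]
    rfl
  rw [h]
  refine Submodule.sum_mem _ fun σ _ => Submodule.smul_mem _ _ ?_
  simpa using prod_mem_bidegreeSpace (K := K) Finset.univ (fun _ : Fin n => 0) (fun _ => 1)
    fun i _ => cInv_mem_bidegreeSpace (σ i) i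

/-- Right translation is an algebra map that preserves the span of the `c i j` and the span of the
`cInv i j`. -/
theorem rightInvariant_bidegreeSpace (r s : ℕ) : RightInvariant (bidegreeSpace n K r s) := by
  intro f hf h
  let T : (GeneralLinearGroup (Fin n) K → K) →ₐ[K] (GeneralLinearGroup (Fin n) K → K) :=
    AlgHom.pi fun g => Pi.evalAlgHom K _ (g * h)
  have hc : ∀ i j, T (c i j) ∈ bidegreeSpace n K 1 0 := by
    intro i j
    have e : T (c i j) = ∑ k, (c k j h) • c i k := by
      funext g
      simp [T, c, Matrix.mul_apply, mul_comm]
    rw [e]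
    exact Submodule.sum_mem _ fun k _ => Submodule.smul_mem _ _ (c_mem_bidegreeSpace i k)
  have hcInv : ∀ i j, T (cInv i j) ∈ bidegreeSpace n K 0 1 := by
    intro i j
    have e : T (cInv i j) = ∑ k, (cInv i k h) • cInv k j := by
      funext g
      change ((g * h)⁻¹ : GeneralLinearGroup (Fin n) K).1 i j = _
      rw [mul_inv_rev, Units.val_mul, Matrix.mul_apply]
      simp only [Finset.sum_apply]
      rfl
    rw [e]
    exact Submodule.sum_mem _ fun k _ => Submodule.smul_mem _ _ (cInv_mem_bidegreeSpace k j)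
  suffices bidegreeSpace n K r s ≤ (bidegreeSpace n K r s).comap T.toLinearMap from this hf
  refine Submodule.span_le.2 ?_
  rintro _ ⟨a, b, rfl, rfl, rfl⟩
  rw [SetLike.mem_coe, Submodule.mem_comap, AlgHom.toLinearMap_apply]
  simp only [map_mul, map_prod, map_pow]
  have h1 := prod_mem_bidegreeSpace Finset.univ _ _ fun i _ =>
    prod_mem_bidegreeSpace Finset.univ _ _ fun j _ => pow_mem_bidegreeSpace (a i j) (hc i j)
  have h2 := prod_mem_bidegreeSpace Finset.univ _ _ fun i _ =>
    prod_mem_bidegreeSpace Finset.univ _ _ fun j _ => pow_mem_bidegreeSpace (b i j) (hcInv i j)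
  simpa using mul_mem_bidegreeSpace h1 h2

theorem RightInvariant.iSup {G ι : Type*} [Monoid G] {F : ι → Submodule K (G → K)}
    (hF : ∀ i, RightInvariant (F i)) : RightInvariant (⨆ i, F i) := by
  intro f hf h
  let T : (G → K) →ₗ[K] (G → K) := LinearMap.funLeft K K fun g => g * h
  suffices (⨆ i, F i) ≤ (⨆ i, F i).comap T from this hf
  exact iSup_le fun i f hf => Submodule.mem_iSup_of_mem i (hF i f hf h)

theorem rightInvariant_degreeSpace (z : ℤ) : RightInvariant (degreeSpace n K z) :=
  RightInvariant.iSup fun _ => rightInvariant_bidegreeSpace _ _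

theorem apply_mul_scalar_of_mem_bidegreeSpace {r s : ℕ} {f : GeneralLinearGroup (Fin n) K → K}
    (hf : f ∈ bidegreeSpace n K r s) (g : GeneralLinearGroup (Fin n) K) (x : Kˣ) :
    f (g * GeneralLinearGroup.scalar (Fin n) x) = ((x ^ ((r : ℤ) - s) : Kˣ) : K) * f g := by
  induction hf using Submodule.span_induction with
  | mem f hf =>
    obtain ⟨a, b, rfl, rfl, rfl⟩ := hf
    have hc : ∀ (g : GeneralLinearGroup (Fin n) K) (x : Kˣ) (i j : Fin n),
        c i j (g * GeneralLinearGroup.scalar (Fin n) x) = x * c i j g := by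
      intro g x i j
      simp [c, GeneralLinearGroup.coe_scalar, Matrix.scalar_apply, mul_comm]
    have hcInv : ∀ i j, cInv i j (g * GeneralLinearGroup.scalar (Fin n) x) =
        ((x⁻¹ : Kˣ) : K) * cInv i j g := by
      intro i j
      rw [cInv, mul_inv_rev, ← map_inv, GeneralLinearGroup.scalar_commute, hc, cInv]
    simp only [Pi.mul_apply, Finset.prod_apply, Pi.pow_apply, hc, hcInv, mul_pow,
      Finset.prod_mul_distrib, Finset.prod_pow_eq_pow_sum]
    rw [zpow_sub, zpow_natCast, zpow_natCast]
    push_cast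
    rw [inv_pow]
    ring
  | zero => simp
  | add f f' _ _ h h' => simp only [Pi.add_apply, h, h', mul_add]
  | smul a f _ h => simp only [Pi.smul_apply, smul_eq_mul, h]; ring

theorem apply_mul_scalar_of_mem_degreeSpace (hn : 0 < n) {z : ℤ}
    {f : GeneralLinearGroup (Fin n) K → K}
    (hf : f ∈ degreeSpace n K z) (g : GeneralLinearGroup (Fin n) K) (x : Kˣ) :
    f (g * GeneralLinearGroup.scalar (Fin n) x) = ((x ^ z : Kˣ) : K) * f g := by
  obtain ⟨t, ht⟩ := (mem_degreeSpace_iff hn z f).1 hf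
  rw [apply_mul_scalar_of_mem_bidegreeSpace ht]
  congr 3
  omega

theorem bidegreeSpace_le_degreeSpace (r s : ℕ) :
    bidegreeSpace n K r s ≤ degreeSpace n K ((r : ℤ) - s) := by
  -- Removing `min r s` from both indices leaves the positive and negative parts of `r - s`.
  refine le_iSup_of_le (min r s) (le_of_eq ?_)
  congr 1 <;> omega

theorem regularAlgebra_le_iSup_degreeSpace :
    Subalgebra.toSubmodule (regularAlgebra n K) ≤ ⨆ z, degreeSpace n K z := by
  rw [regularAlgebra, Algebra.adjoin_eq_span, Submodule.span_le]
  intro f hf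
  suffices ∃ r s, f ∈ bidegreeSpace n K r s by
    obtain ⟨r, s, h⟩ := this
    exact Submodule.mem_iSup_of_mem _ (bidegreeSpace_le_degreeSpace r s h)
  induction hf using Submonoid.closure_induction with
  | mem f hf =>
    rcases hf with ⟨i, j, rfl⟩ | rfl
    · exact ⟨1, 0, c_mem_bidegreeSpace i j⟩
    · exact ⟨0, n, dInv_mem_bidegreeSpace⟩
  | one =>
    exact ⟨0, 0, SetLike.one_mem_graded fun p : ℕ × ℕ => bidegreeSpace n K p.1 p.2⟩
  | mul f g _ _ hf hg =>
    obtain ⟨r, s, hf⟩ := hf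
    obtain ⟨r', s', hg⟩ := hg
    exact ⟨_, _, mul_mem_bidegreeSpace hf hg⟩

theorem rank_regularAlgebra_le :
    Module.rank K (Subalgebra.toSubmodule (regularAlgebra n K)) ≤ Cardinal.aleph0 := by
  rw [regularAlgebra, Algebra.adjoin_eq_span]
  refine Submodule.rank_span_le_aleph0 (Submonoid.countable_closure ?_)
  refine Set.Countable.union ?_ (Set.countable_singleton _)
  refine (Set.countable_range fun p : Fin n × Fin n =>
    (c p.1 p.2 : GeneralLinearGroup (Fin n) K → K)).mono ?_
  rintro _ ⟨i, j, rfl⟩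
  exact ⟨(i, j), rfl⟩

end Functions

/-! ### Degree and bidegree components of a rational module -/

section Modules

variable {n : ℕ} {K : Type*} [Field K] {V : Type*} [AddCommGroup V] [Module K V]
  {ρ : Representation K (GeneralLinearGroup (Fin n) K) V}

theorem IsRational.toRepresentation (hρ : IsRational ρ) (W : Subrepresentation ρ) :
    IsRational W.toRepresentation :=
  (coeffSpace_toRepresentation_le ρ W).trans hρ

theorem IsRational.finiteDimensional_orbitSpan (hρ : IsRational ρ) (v : V) :
    FiniteDimensional K (orbitSpan ρ v).toSubmodule :=
  RationalGL.finiteDimensional_orbitSpan ρ _ rank_regularAlgebra_le hρ v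

/-- Compactness reduces containment in an infinite supremum of function spaces to a finite one. -/
theorem IsRational.isCompactElement_range_coeffMap (hρ : IsRational ρ) (v : V) :
    IsCompactElement (LinearMap.range (coeffMap ρ v)) :=
  have := hρ.finiteDimensional_orbitSpan v
  (Submodule.fg_iff_compact _).1 (fg_range_coeffMap ρ v)

/-- A finitely generated module of rational degree `z` has some bidegree. -/
theorem IsRational.exists_range_coeffMap_le (hn : 0 < n) (hρ : IsRational ρ) {z : ℤ} {v : V}
    (hv : ∀ φ, coeffMap ρ v φ ∈ degreeSpace n K z) :
    ∃ t : ℕ, ∀ φ, coeffMap ρ v φ ∈ bidegreeSpace n K (z.toNat + t) ((-z).toNat + t) := by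
  have hle : LinearMap.range (coeffMap ρ v) ≤ degreeSpace n K z := by
    rintro _ ⟨φ, rfl⟩
    exact hv φ
  have hmono : Monotone fun t : ℕ => bidegreeSpace n K (z.toNat + t) ((-z).toNat + t) :=
    monotone_nat_of_le_succ fun t => bidegreeSpace_le_succ hn K _ _
  obtain ⟨s, hs⟩ := CompleteLattice.IsCompactElement.exists_finset_of_le_iSup _
    (hρ.isCompactElement_range_coeffMap v) _ hle
  refine ⟨s.sup id, fun φ => ?_⟩
  have h2 : (⨆ t ∈ s, bidegreeSpace n K (z.toNat + t) ((-z).toNat + t)) ≤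
      bidegreeSpace n K (z.toNat + s.sup id) ((-z).toNat + s.sup id) :=
    iSup₂_le fun t ht => hmono (Finset.le_sup (f := id) ht)
  exact h2 (hs ⟨φ, rfl⟩)

variable (ρ)

/-- The component of rational degree `z` of a representation of `GL_n(K)`. -/
def degreeComponent (z : ℤ) : Subrepresentation ρ :=
  coeffSubrep ρ (degreeSpace n K z) (rightInvariant_degreeSpace z)

/-- The largest subrepresentation of bidegree `(r, s)` of a representation of `GL_n(K)`. -/
def bidegreeComponent (r s : ℕ) : Subrepresentation ρ :=
  coeffSubrep ρ (bidegreeSpace n K r s) (rightInvariant_bidegreeSpace r s)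

variable {ρ}

theorem apply_scalar_of_mem_degreeComponent (hn : 0 < n) {z : ℤ} {v : V}
    (hv : v ∈ (degreeComponent ρ z).toSubmodule) (x : Kˣ) :
    ρ (GeneralLinearGroup.scalar (Fin n) x) v = ((x ^ z : Kˣ) : K) • v := by
  rw [← sub_eq_zero, ← Module.forall_dual_apply_eq_zero_iff K]
  intro φ
  have := apply_mul_scalar_of_mem_degreeSpace hn (hv φ) 1 x
  simp only [one_mul, coeffMap_apply, map_one, Module.End.one_apply] at this
  rw [map_sub, this, map_smul, smul_eq_mul, sub_self]

theorem iSupIndep_degreeComponent [Infinite K] (hn : 0 < n) :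
    iSupIndep fun z => (degreeComponent ρ z).toSubmodule := by
  classical
  rw [iSupIndep_iff_finsetSum_eq_zero_imp_eq_zero]
  intro S v hv hsum z hz
  obtain ⟨a, ha⟩ := exists_finsupp_sum_zpow K S z
  have h1 : (a.sum fun x t => t • ρ (GeneralLinearGroup.scalar (Fin n) x) (∑ w ∈ S, v w)) =
      ∑ w ∈ S, (a.sum fun x t => t * ((x ^ w : Kˣ) : K)) • v w := by
    simp only [Finsupp.sum, map_sum, Finset.smul_sum, Finset.sum_smul]
    rw [Finset.sum_comm]
    refine Finset.sum_congr rfl fun w hw => Finset.sum_congr rfl fun x _ => ?_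
    rw [apply_scalar_of_mem_degreeComponent hn (hv w hw), smul_smul]
  rw [hsum, Finset.sum_congr rfl fun w hw => by rw [ha w hw]] at h1
  simpa [hz] using h1.symm

/-- Splitting coefficient functions by degree is done for each `φ` separately; the point is that the
pieces come from vectors independent of `φ`. -/
theorem iSup_degreeComponent [Infinite K] (hn : 0 < n) (hρ : IsRational ρ) :
    ⨆ z, (degreeComponent ρ z).toSubmodule = ⊤ := by
  classical
  rw [eq_top_iff]
  intro v _
  have hle : LinearMap.range (coeffMap ρ v) ≤ ⨆ z, degreeSpace n K z := by
    rintro _ ⟨φ, rfl⟩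
    exact regularAlgebra_le_iSup_degreeSpace (hρ (coeffMap_mem_coeffSpace ρ v φ))
  obtain ⟨S, hS⟩ := CompleteLattice.IsCompactElement.exists_finset_of_le_iSup _
    (hρ.isCompactElement_range_coeffMap v) _ hle
  have hdec : ∀ φ, ∃ f : ℤ → GeneralLinearGroup (Fin n) K → K,
      (∀ w, f w ∈ degreeSpace n K w) ∧ ∑ w ∈ S, f w = coeffMap ρ v φ := by
    intro φ
    obtain ⟨μ, hμ⟩ := (Submodule.mem_iSup_finset_iff_exists_sum _ _).1 (hS ⟨φ, rfl⟩)
    exact ⟨fun w => μ w, fun w => (μ w).2, hμ⟩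
  choose f hf hsum using hdec
  choose a ha using fun z => exists_finsupp_sum_zpow K S z
  -- The combination of scalars `a z` projects onto degree `z`. It serves all `φ` at once because
  -- the finite set `S` was chosen for the whole range of `coeffMap ρ v`.
  let p : ℤ → V := fun z =>
    (a z).sum fun x t => t • ρ (GeneralLinearGroup.scalar (Fin n) x) v
  have hp : ∀ z ∈ S, ∀ φ, coeffMap ρ (p z) φ = f φ z := by
    intro z hz φ
    funext g
    have h1 : coeffMap ρ (p z) φ g = (a z).sum fun x t =>
        t * coeffMap ρ v φ (g * GeneralLinearGroup.scalar (Fin n) x) := by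
      simp [p, Finsupp.sum, map_sum]
    have h2 : ((a z).sum fun x t => t * coeffMap ρ v φ (g * GeneralLinearGroup.scalar (Fin n) x)) =
        ∑ w ∈ S, ((a z).sum fun x t => t * ((x ^ w : Kˣ) : K)) * f φ w g := by
      simp only [← hsum φ, Finsupp.sum, Finset.sum_apply, Finset.mul_sum, Finset.sum_mul]
      rw [Finset.sum_comm]
      refine Finset.sum_congr rfl fun w _ => Finset.sum_congr rfl fun x _ => ?_
      rw [apply_mul_scalar_of_mem_degreeSpace hn (hf φ w), mul_assoc]
    rw [h1, h2, Finset.sum_congr rfl fun w hw => by rw [ha z w hw]]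
    simp [hz]
  have hv : v = ∑ z ∈ S, p z := by
    rw [← sub_eq_zero, ← Module.forall_dual_apply_eq_zero_iff K]
    intro φ
    have h1 : ∀ z ∈ S, φ (p z) = f φ z 1 := by
      intro z hz
      simpa using congrFun (hp z hz φ) 1
    have h2 : ∑ z ∈ S, f φ z 1 = φ v := by
      simpa using congrFun (hsum φ) 1
    rw [map_sub, map_sum, Finset.sum_congr rfl h1, h2, sub_self]
  rw [hv]
  refine Submodule.sum_mem _ fun z hz => Submodule.mem_iSup_of_mem z ?_
  intro φ
  rw [hp z hz φ]
  exact hf φ z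

theorem hasDegree_degreeComponent (hρ : IsRational ρ) (z : ℤ) :
    HasDegree (degreeComponent ρ z).toRepresentation z := by
  have hle : coeffSpace (degreeComponent ρ z).toRepresentation ≤ degreeSpace n K z :=
    coeffSpace_coeffSubrep_le ρ _ _
  have hrat := hρ.toRepresentation (degreeComponent ρ z)
  exact ⟨fun _ => hle, fun _ v => ⟨orbitSpan _ v, self_mem_orbitSpan _ v,
    hrat.finiteDimensional_orbitSpan v, hrat.toRepresentation _,
    (coeffSpace_toRepresentation_le _ _).trans hle⟩⟩

theorem hasBidegree_bidegreeComponent (r s : ℕ) :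
    HasBidegree (bidegreeComponent ρ r s).toRepresentation r s :=
  coeffSpace_coeffSubrep_le ρ _ _

theorem monotone_bidegreeComponent (hn : 0 < n) (r s : ℕ) :
    Monotone fun t => bidegreeComponent ρ (r + t) (s + t) :=
  monotone_nat_of_le_succ fun _ _ hv φ => bidegreeSpace_le_succ hn K _ _ (hv φ)

theorem coe_degreeComponent (hn : 0 < n) (hρ : IsRational ρ) (z : ℤ) :
    (degreeComponent ρ z : Set V) =
      ⋃ t : ℕ, (bidegreeComponent ρ (z.toNat + t) ((-z).toNat + t) : Set V) := by
  ext v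
  simp only [Set.mem_iUnion, SetLike.mem_coe]
  refine ⟨fun hv => hρ.exists_range_coeffMap_le hn hv, ?_⟩
  rintro ⟨t, ht⟩ φ
  exact (mem_degreeSpace_iff hn z _).2 ⟨t, ht φ⟩

end Modules

end RationalGL

theorem mainTheorem8 {K : Type*} [Field K] [Infinite K] (n : ℕ) (hn : 2 ≤ n)
    {V : Type*} [AddCommGroup V] [Module K V]
    (ρ : Representation K (Matrix.GeneralLinearGroup (Fin n) K) V)
    (hρ : RationalGL.IsRational ρ) :
    ∃ Vz : ℤ → Subrepresentation ρ,
      DirectSum.IsInternal (fun z => (Vz z).toSubmodule) ∧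
      (∀ z : ℤ, RationalGL.IsRational (Vz z).toRepresentation ∧
        RationalGL.HasDegree (Vz z).toRepresentation z) ∧
      (∀ z : ℕ, ∃ U : ℕ → Subrepresentation ρ, Monotone U ∧
        (∀ t : ℕ, RationalGL.IsRational (U t).toRepresentation ∧
          RationalGL.HasBidegree (U t).toRepresentation (z + t) t) ∧
        (Vz (z : ℤ) : Set V) = ⋃ t : ℕ, (U t : Set V)) ∧
      (∀ z : ℕ, ∃ U : ℕ → Subrepresentation ρ, Monotone U ∧
        (∀ t : ℕ, RationalGL.IsRational (U t).toRepresentation ∧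
          RationalGL.HasBidegree (U t).toRepresentation t (z + t)) ∧
        (Vz (-(z : ℤ)) : Set V) = ⋃ t : ℕ, (U t : Set V)) := by
  have hn0 : 0 < n := by omega
  refine ⟨RationalGL.degreeComponent ρ,
    DirectSum.isInternal_submodule_of_iSupIndep_of_iSup_eq_top
      (RationalGL.iSupIndep_degreeComponent hn0) (RationalGL.iSup_degreeComponent hn0 hρ),
    fun z => ⟨hρ.toRepresentation _, RationalGL.hasDegree_degreeComponent hρ z⟩,
    fun z => ⟨fun t => RationalGL.bidegreeComponent ρ (z + t) t, ?_,
      fun t => ⟨hρ.toRepresentation _, RationalGL.hasBidegree_bidegreeComponent _ _⟩, ?_⟩,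
    fun z => ⟨fun t => RationalGL.bidegreeComponent ρ t (z + t), ?_,
      fun t => ⟨hρ.toRepresentation _, RationalGL.hasBidegree_bidegreeComponent _ _⟩, ?_⟩⟩
  · simpa using RationalGL.monotone_bidegreeComponent (ρ := ρ) hn0 z 0
  -- For either sign of the degree one of the two `toNat` terms vanishes, leaving the required
  -- chain.
  · simpa using RationalGL.coe_degreeComponent hn0 hρ (z : ℤ)
  · simpa using RationalGL.monotone_bidegreeComponent (ρ := ρ) hn0 0 z
  · simpa using RationalGL.coe_degreeComponent hn0 hρ (-(z : ℤ))
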